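/- **Setting.** A weighted pushdown automaton $\Delta=(Q,\Gamma,\delta)$ has finite sets $Q$ of states and $\Gamma$ of stack symbols, and transitions $pZ\xrightarrow{a}q\alpha$ with rational weights $a\ge 0$, $p,q\in Q$, $Z\in\Gamma$, $\alpha\in\Gamma^*$, $|\alpha|\le 2$, at most one for each $(p,Z,q,\alpha)$. It is a pPDA if the weights of the transitions from each $pZ$ sum to $1$. It induces the transition matrix $T$ on configurations $Q\times\Gamma^*$ with $T(pZ\beta,q\alpha\beta)=a$ for each transition $pZ\xrightarrow{a}q\alpha$ and each $\beta\in\Gamma^*$, and all other entries $0$. Let $F=Q\times\{\varepsilon\}$ and let $T_F$ be $T$ with the rows in $F$ set to zero. For a configuration $c$, $[c\mid F]$ is the sum, over all finite paths from $c$ that visit $F$ exactly once, at their end, of the product of the transition weights, and $\mathsf{ert}[c]=\big(\sum_{k\ge 0}T_F^k(\mathbf 1-\chi_F)\big)_c\in[0,\infty]$. $\Delta$ is AST if $[c\mid F]=1$ for all configurations $c$, and PAST if $\mathsf{ert}[c]<\infty$ for all configurations $c$. The fundamental PPS $f$ of $\Delta$ is the polynomial system, in variables $x_{pZq}$ with $p,q\in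 Q$, $Z\in\Gamma$, $$f_{pZq}(x)=\sum_{pZ\xrightarrow{a}q\varepsilon}a+\sum_{pZ\xrightarrow{a}rY}a\,x_{rYq}+\sum_{pZ\xrightarrow{a}rYX}a\sum_{t\in Q}x_{rYt}\,x_{tXq},$$ and $\mu f$ is its least fixed point in $[0,\infty]^{Q\times\Gamma\times Q}$. For $u\in[0,\infty]^{Q\times\Gamma\times Q}$, the matrix $M_\Delta(u)$ indexed by $Q\times\Gamma$ is defined by $$(M_\Delta(u)\,r)_{pZ}=\sum_{pZ\xrightarrow{a}sY}a\,r_{sY}+\sum_{pZ\xrightarrow{a}sYX}a\Big(r_{sY}+\sum_{t\in Q}u_{sYt}\,r_{tX}\Big).$$ Inequalities between vectors are componentwise, and $0\cdot\infty=0$. **Statement.** 1. Let $\Delta$ be a pPDA with fundamental PPS $f$ and let $\mu f\le u$. If some $r\in\mathbb R_{\ge 1}^{Q\times\Gamma}$ satisfies $M_\Delta(u)\,r+\mathbf 1\le r$, then $\Delta$ is PAST, and $\mathsf{ert}[pZ]\le r_{pZ}$ for all $pZ\in Q\times\Gamma$. 2. Let $\Delta$ be a pPDA with fundamental PPS $f$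 and let $u^{(0)}\ge u^{(1)}\ge\dots\ge\mu f$ be a sequence with $\lim_i u^{(i)}=\mu f$. Consider the procedure that, for $i=0,1,2,\dots$, reports "PAST" and stops if $M_\Delta(u^{(i)})\,r+\mathbf 1\le r$ has a solution $r\in\mathbb R_{\ge 0}^{Q\times\Gamma}$; else reports "non-AST" and stops if $\sum_{t\in Q}u^{(i)}_{pZt}<1$ for some $pZ\in Q\times\Gamma$; else continues with $i+1$. It reports "PAST" if and only if $\Delta$ is PAST, and "non-AST" if and only if $\Delta$ is not AST (so it diverges exactly if $\Delta$ is AST but not PAST). 3. This yields a semi-algorithm, uniformly in $\Delta$: for every computable function $U$ that maps a finite description of a weighted pushdown automaton $\Delta$, a number $i$ and an index $pZq$ to a rational number $u^{(i)}_{pZq}\ge 0$, there is a partial computable function $A$ such that, for every description of a pPDA $\Delta$ for which the computed sequence satisfies $u^{(0)}\ge u^{(1)}\ge\dots\ge\mu f$ and $\lim_i u^{(i)}=\mu f$, $A$ returns "PAST" if and only if $\Delta$ is PAST, and "non-AST" if and only if $\Delta$ is not AST. -/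

import Mathlib

open scoped ENNReal NNReal Topology

noncomputable section

/-! ## Weighted transition systems and Markov chains with a target set -/

namespace WTS

variable {S : Type*}

/-- Weight of a finite path `s₀ … sₗ`: the product of the `M sᵢ sᵢ₊₁`
(`1` for a path of length zero). -/
def pathWeight (M : S → S → ℝ≥0∞) : List S → ℝ≥0∞
  | [] => 1
  | [_] => 1
  | s :: t :: π => M s t * pathWeight M (t :: π)

/-- The proper paths between `s` and `F`: non-empty finite paths that start in `s` and visit `F`
exactly once, namely at the end. -/
def properPaths (F : Set S) (s : S) : Set (List S) :=
  {π | π.head? = some s ∧ (∃ t ∈ F, π.getLast? = some t) ∧ ∀ x ∈ π.dropLast, x ∉ F}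

/-- The zeroth termination moment `[s | F]`: the total weight of all proper paths between `s`
and `F` (in a Markov chain: the probability to reach `F` from `s`). -/
def termMoment₀ (M : S → S → ℝ≥0∞) (F : Set S) (s : S) : ℝ≥0∞ :=
  ∑' π : properPaths F s, pathWeight M π

open Classical in
/-- The matrix-vector product `M_F v`, where `M_F` is `M` with all rows in `F` set to zero. -/
def applyOff (M : S → S → ℝ≥0∞) (F : Set S) (v : S → ℝ≥0∞) (s : S) : ℝ≥0∞ :=
  if s ∈ F then 0 else ∑' t, M s t * v t

open Classical in
/-- The vector `1 - χ(F)`. -/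
def offTarget (F : Set S) (s : S) : ℝ≥0∞ := if s ∈ F then 0 else 1

/-- The expected runtime `ert[s | F] = (∑ₖ M_F ^ k (1 - χ(F)))ₛ`. -/
def ert (M : S → S → ℝ≥0∞) (F : Set S) (s : S) : ℝ≥0∞ :=
  ∑' k : ℕ, (applyOff M F)^[k] (offTarget F) s

/-- Almost-sure termination, from every initial state. -/
def AST (M : S → S → ℝ≥0∞) (F : Set S) : Prop := ∀ s, termMoment₀ M F s = 1

/-- Positive almost-sure termination, from every initial state. -/
def PAST (M : S → S → ℝ≥0∞) (F : Set S) : Prop := ∀ s, ert M F s < ∞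

end WTS

/-! ## Positive polynomial systems -/

/-- A positive polynomial system with variables (and equations) indexed by `J`. -/
abbrev PPS (J : Type*) := J → MvPolynomial J ℝ≥0

namespace PPS

variable {J : Type*}

/-- The monotone map on `[0,∞]^J` induced by a positive polynomial system. -/
def toOrderHom (f : PPS J) : (J → ℝ≥0∞) →o (J → ℝ≥0∞) where
  toFun u j := MvPolynomial.aeval u (f j)
  monotone' := by
    intro u v huv j
    simp only [MvPolynomial.aeval_def, MvPolynomial.eval₂_eq]
    gcongr with d _ i _
    exact huv i

/-- The least fixed point `μf`. -/
def lfp (f : PPS J) : J → ℝ≥0∞ := OrderHom.lfp f.toOrderHom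

end PPS

/-! ## Weighted and probabilistic pushdown automata -/

/-- A weighted pushdown automaton with states `Q` and stack alphabet `Γ`: `weight p Z q α` is the
rational weight `a ≥ 0` of the transition from `pZ` to `qα`, where `α` has length at most two;
weight `0` means that there is no such transition. -/
structure WeightedPDA (Q Γ : Type*) where
  weight : Q → Γ → Q → List Γ → ℚ≥0
  weight_eq_zero : ∀ p Z q α, 2 < α.length → weight p Z q α = 0

namespace WeightedPDA

variable {Q Γ : Type*} (Δ : WeightedPDA Q Γ)

/-- The weight as a real number. -/
def rweight (p : Q) (Z : Γ) (q : Q) (α : List Γ) : ℝ≥0 := (Δ.weight p Z q α : ℝ≥0)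

/-- A probabilistic PDA: the outgoing weights of every `pZ` sum up to one. -/
def IsProbabilistic [Fintype Q] [Fintype Γ] : Prop :=
  ∀ p Z, ∑ q, (Δ.weight p Z q [] + ∑ Y, Δ.weight p Z q [Y]
    + ∑ Y, ∑ X, Δ.weight p Z q [Y, X]) = 1

open Classical in
/-- The transition matrix on configurations `Q × Γ*` (the top of the stack is the head of the
list): the entry at `(pZβ, qαβ)` is the weight of the transition from `pZ` to `qα`, and all other
entries are zero. -/
def trans : Q × List Γ → Q × List Γ → ℝ≥0∞
  | (_, []), _ => 0
  | (p, Z :: β), (q, γ) =>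
    if β <:+ γ then (Δ.rweight p Z q (γ.take (γ.length - β.length)) : ℝ≥0∞) else 0

/-- The configurations with empty stack. -/
def emptyStack (Q Γ : Type*) : Set (Q × List Γ) := {c | c.2 = []}

/-- Almost-sure termination of a pPDA. -/
def AST : Prop := WTS.AST Δ.trans (emptyStack Q Γ)

/-- Positive almost-sure termination of a pPDA. -/
def PAST : Prop := WTS.PAST Δ.trans (emptyStack Q Γ)

/-- The expected runtime `ert[pZ]`. -/
def ert (p : Q) (Z : Γ) : ℝ≥0∞ := WTS.ert Δ.trans (emptyStack Q Γ) (p, [Z])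

variable [Fintype Q] [Fintype Γ]

open MvPolynomial in
/-- The fundamental PPS of `Δ`, with variables `⟨pZ|q⟩`. -/
def fundamentalPPS : PPS (Q × Γ × Q) := fun (p, Z, q) =>
  C (Δ.rweight p Z q [])
  + ∑ r, ∑ Y, C (Δ.rweight p Z r [Y]) * X (r, Y, q)
  + ∑ r, ∑ Y, ∑ W, C (Δ.rweight p Z r [Y, W]) * ∑ t, X (r, Y, t) * X (t, W, q)

/-- The matrix `M_Δ(u)`: the coefficients of the variables `ert⟨sV⟩` in the linear system
`ert⟨pZ⟩ = 1 + ∑_{pZ →ᵃ rY} a ert⟨rY⟩ + ∑_{pZ →ᵃ rYX} a (ert⟨rY⟩ + ∑ₜ u_{rYt} ert⟨tX⟩)`. -/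
def ertMatrix (u : Q × Γ × Q → ℝ≥0∞) : Matrix (Q × Γ) (Q × Γ) ℝ≥0∞ :=
  Matrix.of fun (p, Z) (s, V) =>
    (Δ.rweight p Z s [V] : ℝ≥0∞)
    + ∑ W, (Δ.rweight p Z s [V, W] : ℝ≥0∞)
    + ∑ r, ∑ Y, (Δ.rweight p Z r [Y, V] : ℝ≥0∞) * u (r, Y, s)

/-- The real vector `r ≥ 0` satisfies `M_Δ(u) r + 1 ≤ r`. -/
def IsErtBound (u : Q × Γ × Q → ℝ≥0∞) (r : Q × Γ → ℝ≥0) : Prop :=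
  (Δ.ertMatrix u).mulVec (fun x => (r x : ℝ≥0∞)) + 1 ≤ fun x => (r x : ℝ≥0∞)

/-- `u⁽⁰⁾ ≥ u⁽¹⁾ ≥ … ≥ μf` converges to `μf`, for the fundamental PPS `f` of `Δ`. -/
def IsUpperScheme (u : ℕ → Q × Γ × Q → ℝ≥0∞) : Prop :=
  Antitone u ∧ (∀ i, Δ.fundamentalPPS.lfp ≤ u i) ∧
    Filter.Tendsto u Filter.atTop (𝓝 Δ.fundamentalPPS.lfp)

open Classical in
/-- One round of the semi-algorithm, with the upper bound `u`: report `true` (PAST) if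
`M_Δ(u) r + 1 ≤ r` is feasible in the non-negative reals; else report `false` (non-AST) if
`∑ₜ u_{pZt} < 1` for some `pZ`; else report nothing. -/
def verdict (u : Q × Γ × Q → ℝ≥0∞) : Option Bool :=
  if ∃ r : Q × Γ → ℝ≥0, Δ.IsErtBound u r then some true
  else if ∃ p Z, ∑ t, u (p, Z, t) < 1 then some false
  else none

/-- The semi-algorithm: the first report made in the rounds `i = 0, 1, 2, …`, undefined if there
is none. -/
def semiAlgorithm (u : ℕ → Q × Γ × Q → ℝ≥0∞) : Part Bool :=
  Nat.rfindOpt fun i => Δ.verdict (u i)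

end WeightedPDA

/-- The outcome `o` of a possibly diverging computation decides between PAST and non-AST: it is
`true` iff `Δ` is PAST and `false` iff `Δ` is not AST. (So it is undefined iff `Δ` is AST but not
PAST.) -/
def DecidesTermination {Q Γ : Type*} (Δ : WeightedPDA Q Γ) (o : Part Bool) : Prop :=
  (true ∈ o ↔ Δ.PAST) ∧ (false ∈ o ↔ ¬ Δ.AST)

/-! ## Weighted PDA as finite data -/

/-- The pair `(a, b)` as a representation of the rational number `a / (b + 1)`. -/
def fracVal (x : ℕ × ℕ) : ℚ≥0 := (x.1 : ℚ≥0) / ((x.2 : ℚ≥0) + 1)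

/-- Finite description `(n, m, L)` of a weighted PDA with states `0, …, n - 1` and stack symbols
`0, …, m - 1`; an entry `((p, Z, q, α), a)` of the list `L` stands for a transition from `pZ` to
`qα` of weight `a`, given as a fraction. -/
abbrev PDACode := ℕ × ℕ × List ((ℕ × ℕ × ℕ × List ℕ) × (ℕ × ℕ))

/-- The weighted PDA described by a code (the weights of repeated entries add up). -/
def PDACode.toPDA (c : PDACode) : WeightedPDA (Fin c.1) (Fin c.2.1) where
  weight p Z q α :=
    if α.length ≤ 2 then
      ((c.2.2.filter fun e => e.1 = ((p : ℕ), (Z : ℕ), (q : ℕ), α.map Fin.val)).map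
        fun e => fracVal e.2).sum
    else 0
  weight_eq_zero p Z q α h := by simp [Nat.not_le.mpr h]

/-- The sequence of vectors that a scheme `U` of fractions, indexed by a code, a round `i` and an
index `(p, Z, q)`, computes for the code `c`. -/
def schemeSeq (U : PDACode × ℕ × ℕ × ℕ × ℕ → ℕ × ℕ) (c : PDACode) (i : ℕ) :
    Fin c.1 × Fin c.2.1 × Fin c.1 → ℝ≥0∞ :=
  fun (p, Z, q) => ((fracVal (U (c, i, p, Z, q)) : ℝ≥0) : ℝ≥0∞)

end

noncomputable section

/-! Everything rests on one decomposition, `totalReward_append`: a run on the stack `αβ` first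
removes `α`, ending in some state `t`, and then continues on `β` from `t`. Applied to termination
rewards it shows that `μf` consists of the probabilities to pop a single symbol
(`lfp_fundamentalPPS`); applied to unit rewards it shows that the expected times `e` satisfy `M(μf)
e + 1 = e` in `[0,∞]` (`step_popTime_add_one`).

Soundness: if `M(u) r + 1 ≤ r` with `u ≥ μf`, then `r` bounds the expected time truncated at `n`
steps for every `n`, by induction (`expTime_le_of_isErtBound`). A row sum of `u` below `1` bounds a
termination probability away from `1`.

Completeness: if `e` is finite, then `ρ = ⌊3e⌋` satisfies `M(μf) ρ + 2 ≤ ρ`, and the spare unit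
absorbs the error of replacing `μf` by a late `u⁽ⁱ⁾` (`exists_isErtBound_natCast`). If AST fails,
some row sum of `μf` is below `1`, hence so is that of a late `u⁽ⁱ⁾`. Since PAST implies AST, sound
reports never conflict, and the first one is right.

Because `ρ` is integral, an algorithm can enumerate pairs of a round and a natural vector and check
finitely many rational inequalities, without solving a linear program. -/

theorem ENNReal.tsum_list {S : Type*} (h : List S → ℝ≥0∞) :
    ∑' l, h l = h [] + ∑' x, ∑' l, h (x :: l) := by
  let e : Unit ⊕ S × List S ≃ List S :=
    { toFun := Sum.elim (fun _ => []) fun x => x.1 :: x.2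
      invFun := fun l => match l with
        | [] => Sum.inl ()
        | x :: l => Sum.inr (x, l)
      left_inv := by rintro (_ | _) <;> rfl
      right_inv := by rintro (_ | _) <;> rfl }
  rw [← e.tsum_eq h, ENNReal.summable.tsum_sum ENNReal.summable, ← ENNReal.tsum_prod]
  simp [e]

/-! ### Rewards collected until a target set is hit. -/

namespace WTS

variable {S : Type*} (M : S → S → ℝ≥0∞) (F : Set S)

theorem applyOff_of_mem {s : S} (hs : s ∈ F) (v : S → ℝ≥0∞) : applyOff M F v s = 0 := by
  simp [applyOff, hs]

theorem applyOff_of_notMem {s : S} (hs : s ∉ F) (v : S → ℝ≥0∞) :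
    applyOff M F v s = ∑' t, M s t * v t := by
  simp [applyOff, hs]

theorem applyOff_tsum {ι : Type*} (v : ι → S → ℝ≥0∞) :
    applyOff M F (fun s => ∑' i, v i s) = fun s => ∑' i, applyOff M F (v i) s := by
  funext s
  by_cases hs : s ∈ F
  · simp [applyOff, hs]
  · simp only [applyOff, hs, if_false, ← ENNReal.tsum_mul_left]
    exact ENNReal.tsum_comm

theorem applyOff_add (v w : S → ℝ≥0∞) :
    applyOff M F (v + w) = applyOff M F v + applyOff M F w := by
  funext s
  by_cases hs : s ∈ F
  · simp [applyOff, hs]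
  · simp [applyOff, hs, mul_add, ENNReal.tsum_add]

theorem applyOff_finset_sum {ι : Type*} (I : Finset ι) (v : ι → S → ℝ≥0∞) :
    applyOff M F (∑ i ∈ I, v i) = ∑ i ∈ I, applyOff M F (v i) := by
  classical
  induction I using Finset.induction_on with
  | empty => funext s; simp [applyOff]
  | insert i I hi ih => rw [Finset.sum_insert hi, Finset.sum_insert hi, applyOff_add, ih]

theorem applyOff_iterate_add (n : ℕ) (v w : S → ℝ≥0∞) :
    (applyOff M F)^[n] (v + w) = (applyOff M F)^[n] v + (applyOff M F)^[n] w := by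
  induction n generalizing v w with
  | zero => rfl
  | succ n ih => rw [Function.iterate_succ_apply, applyOff_add, ih]; rfl

/-- The total value collected in fewer than `n` steps, if `v s` is earned in each visit of `s`
before (and including) the first visit of `F`. -/
def partialValue (v : S → ℝ≥0∞) (n : ℕ) (s : S) : ℝ≥0∞ :=
  ∑ k ∈ Finset.range n, (applyOff M F)^[k] v s

/-- The total value collected up to the first visit of `F`. -/
def value (v : S → ℝ≥0∞) (s : S) : ℝ≥0∞ := ∑' k : ℕ, (applyOff M F)^[k] v s

variable (v : S → ℝ≥0∞)

@[simp] theorem partialValue_zero (s : S) : partialValue M F v 0 s = 0 := by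
  simp [partialValue]

theorem partialValue_succ (n : ℕ) (s : S) :
    partialValue M F v (n + 1) s = v s + applyOff M F (partialValue M F v n) s := by
  have : partialValue M F v n = ∑ k ∈ Finset.range n, (applyOff M F)^[k] v := by
    funext s; simp [partialValue]
  rw [this, applyOff_finset_sum, partialValue, Finset.sum_range_succ', add_comm]
  simp [Function.iterate_succ_apply']

theorem partialValue_mono (s : S) : Monotone fun n => partialValue M F v n s := by
  intro m n h
  exact Finset.sum_le_sum_of_subset (Finset.range_mono h)

theorem partialValue_le_value (n : ℕ) (s : S) : partialValue M F v n s ≤ value M F v s :=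
  ENNReal.sum_le_tsum _

theorem value_le_of_partialValue_le {s : S} {x : ℝ≥0∞} (h : ∀ n, partialValue M F v n s ≤ x) :
    value M F v s ≤ x := by
  rw [value, ENNReal.tsum_eq_iSup_nat]
  exact iSup_le h

theorem tendsto_partialValue (s : S) :
    Filter.Tendsto (fun n => partialValue M F v n s) Filter.atTop (𝓝 (value M F v s)) :=
  ENNReal.tendsto_nat_tsum _

/-- Split off the term `k = 0` of the series; `applyOff` commutes with countable sums in `[0,∞]`. -/
theorem value_eq (s : S) : value M F v s = v s + applyOff M F (value M F v) s := by
  have : value M F v = fun s => ∑' k : ℕ, (applyOff M F)^[k] v s := rfl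
  rw [this, applyOff_tsum]
  simp only [← Function.iterate_succ_apply' (applyOff M F)]
  rw [tsum_eq_zero_add' ENNReal.summable]
  rfl

theorem value_eq_of_mem {s : S} (hs : s ∈ F) : value M F v s = v s := by
  rw [value_eq, applyOff_of_mem M F hs, add_zero]

theorem ert_eq_value (s : S) : ert M F s = value M F (offTarget F) s := rfl

theorem singleton_mem_properPaths {s t : S} : [t] ∈ properPaths F s ↔ t = s ∧ s ∈ F := by
  simp only [properPaths, Set.mem_ofPred_eq, List.head?_cons, Option.some.injEq,
    List.getLast?_singleton, List.dropLast_singleton, List.not_mem_nil]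
  constructor
  · rintro ⟨rfl, ⟨_, h, rfl⟩, _⟩
    exact ⟨rfl, h⟩
  · rintro ⟨rfl, h⟩
    exact ⟨rfl, ⟨_, h, rfl⟩, by simp⟩

theorem cons_cons_mem_properPaths {s x t : S} {π : List S} :
    x :: t :: π ∈ properPaths F s ↔ x = s ∧ s ∉ F ∧ t :: π ∈ properPaths F t := by
  simp only [properPaths, Set.mem_ofPred_eq, List.head?_cons, Option.some.injEq,
    List.getLast?_cons_cons, List.dropLast_cons_cons, List.mem_cons, forall_eq_or_imp]
  constructor
  · rintro ⟨rfl, h, h', h''⟩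
    exact ⟨rfl, h', trivial, h, h''⟩
  · rintro ⟨rfl, h, _, h', h''⟩
    exact ⟨rfl, h', h, h''⟩

open Classical in
/-- The total weight of the proper paths with `k` transitions. -/
def pathSum (k : ℕ) (s : S) : ℝ≥0∞ :=
  ∑' π : List S, if π ∈ properPaths F s ∧ π.length = k + 1 then pathWeight M π else 0

open Classical in
/-- The characteristic vector of the target set. -/
def onTarget (s : S) : ℝ≥0∞ := if s ∈ F then 1 else 0

/-- Proper paths are non-empty, so each has length `k + 1` for exactly one `k`. -/
theorem termMoment₀_eq_tsum_pathSum (s : S) : termMoment₀ M F s = ∑' k, pathSum M F k s := by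
  classical
  simp only [pathSum]
  rw [ENNReal.tsum_comm, termMoment₀, tsum_subtype (properPaths F s) (pathWeight M)]
  refine tsum_congr fun π => ?_
  by_cases hπ : π ∈ properPaths F s
  · have h0 : π ≠ [] := by
      rintro rfl
      simp [properPaths] at hπ
    obtain ⟨k, hk⟩ : ∃ k, π.length = k + 1 :=
      Nat.exists_eq_succ_of_ne_zero (by simpa using h0)
    rw [tsum_eq_single k]
    · simp [hπ, hk]
    · intro j hj
      rw [if_neg]
      rintro ⟨_, h⟩
      omega
  · simp [hπ]

theorem pathSum_zero : pathSum M F 0 = onTarget F := by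
  classical
  funext s
  rw [pathSum, tsum_eq_single [s]]
  · simp [singleton_mem_properPaths, pathWeight, onTarget]
  · intro π hπ
    rw [if_neg]
    rintro ⟨h, hl⟩
    obtain ⟨t, rfl⟩ := List.length_eq_one_iff.1 hl
    rw [singleton_mem_properPaths] at h
    exact hπ (by rw [h.1])

theorem pathSum_eq_tsum_cons (k : ℕ) (s : S)
    [∀ π, Decidable (s :: π ∈ properPaths F s ∧ π.length = k)] :
    pathSum M F k s = ∑' π : List S,
      if s :: π ∈ properPaths F s ∧ π.length = k then pathWeight M (s :: π) else 0 := by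
  rw [pathSum, ENNReal.tsum_list, tsum_eq_single s]
  · simp
  · intro t ht
    rw [ENNReal.tsum_eq_zero]
    intro π
    rw [if_neg]
    rintro ⟨⟨h, _⟩, _⟩
    exact ht (by simpa using h)

theorem pathSum_succ (k : ℕ) : pathSum M F (k + 1) = applyOff M F (pathSum M F k) := by
  classical
  funext s
  rw [pathSum_eq_tsum_cons, ENNReal.tsum_list]
  by_cases hs : s ∈ F
  · simp [cons_cons_mem_properPaths, hs, applyOff]
  · simp only [cons_cons_mem_properPaths, hs, applyOff, pathSum_eq_tsum_cons,
      ← ENNReal.tsum_mul_left]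
    simp [pathWeight]

/-- This turns the sum over paths into a reward, so that termination and runtime can be treated by
the same lemmas. -/
theorem termMoment₀_eq_value (s : S) : termMoment₀ M F s = value M F (onTarget F) s := by
  rw [termMoment₀_eq_tsum_pathSum, value]
  refine tsum_congr fun k => ?_
  suffices pathSum M F k = (applyOff M F)^[k] (onTarget F) by rw [this]
  induction k with
  | zero => exact pathSum_zero M F
  | succ k ih => rw [pathSum_succ, ih, Function.iterate_succ_apply']

/-! ### Stochastic rows: finite expected runtime implies almost-sure termination. -/

section Stochastic

variable {M F} (hM : ∀ s ∉ F, ∑' t, M s t = 1)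
include hM

theorem applyOff_one : applyOff M F 1 = offTarget F := by
  funext s
  by_cases hs : s ∈ F
  · simp [applyOff, offTarget, hs]
  · simp [applyOff, offTarget, hs, hM s hs]

/-- Conservation of mass: a run has either hit `F` within its first `n` states or not. The induction
replaces the vector `1` by `onTarget F + applyOff M F 1`. -/
theorem partialValue_onTarget_add (n : ℕ) (s : S) :
    partialValue M F (onTarget F) n s + (applyOff M F)^[n] 1 s = 1 := by
  have h1 : (1 : S → ℝ≥0∞) = onTarget F + applyOff M F 1 := by
    funext s
    rw [applyOff_one hM]
    by_cases hs : s ∈ F <;> simp [onTarget, offTarget, hs]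
  induction n with
  | zero => simp
  | succ n ih =>
    rw [h1, applyOff_iterate_add] at ih
    rw [partialValue, Finset.sum_range_succ, add_assoc]
    exact ih

theorem termMoment₀_le_one (s : S) : termMoment₀ M F s ≤ 1 := by
  rw [termMoment₀_eq_value]
  refine value_le_of_partialValue_le _ _ _ fun n => ?_
  rw [← partialValue_onTarget_add hM n s]
  exact le_self_add

theorem termMoment₀_eq_one_of_ert_lt_top {s : S} (h : ert M F s < ∞) : termMoment₀ M F s = 1 := by
  -- The surviving mass after `n + 1` steps is the `n`-th term of the convergent series `ert`.
  have h0 : Filter.Tendsto (fun n => (applyOff M F)^[n + 1] 1 s) Filter.atTop (𝓝 0) := by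
    have := ENNReal.tendsto_atTop_zero_of_tsum_ne_top h.ne
    simpa only [Function.iterate_succ_apply, applyOff_one hM] using this
  have h1 := (((tendsto_partialValue M F (onTarget F) s).comp (Filter.tendsto_add_atTop_nat 1)).add
    h0)
  simp only [Function.comp_def, partialValue_onTarget_add hM, add_zero] at h1
  rw [termMoment₀_eq_value]
  exact tendsto_nhds_unique h1 tendsto_const_nhds

theorem PAST.ast (h : PAST M F) : AST M F := fun s => termMoment₀_eq_one_of_ert_lt_top hM (h s)

end Stochastic

end WTS

/-! ### Rewards on pushdown configurations and splitting of the stack. -/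

namespace WeightedPDA

variable {Q Γ : Type*} (Δ : WeightedPDA Q Γ)

/-- The weighted sum of `g q α` over the transitions from `pZ` to `qα`. -/
def step (p : Q) (Z : Γ) (g : Q → List Γ → ℝ≥0∞) : ℝ≥0∞ :=
  ∑' x : Q × List Γ, (Δ.rweight p Z x.1 x.2 : ℝ≥0∞) * g x.1 x.2

theorem step_mono (p : Q) (Z : Γ) {g h : Q → List Γ → ℝ≥0∞} (hgh : ∀ q α, g q α ≤ h q α) :
    Δ.step p Z g ≤ Δ.step p Z h :=
  ENNReal.tsum_le_tsum fun x => by gcongr; exact hgh _ _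

theorem step_add (p : Q) (Z : Γ) (g h : Q → List Γ → ℝ≥0∞) :
    Δ.step p Z (fun q α => g q α + h q α) = Δ.step p Z g + Δ.step p Z h := by
  simp [step, mul_add, ENNReal.tsum_add]

theorem step_sum_mul {ι : Type*} (I : Finset ι) (p : Q) (Z : Γ) (g : ι → Q → List Γ → ℝ≥0∞)
    (k : ι → ℝ≥0∞) :
    Δ.step p Z (fun q α => ∑ i ∈ I, g i q α * k i) = ∑ i ∈ I, Δ.step p Z (g i) * k i := by
  simp only [step, Finset.mul_sum, ← ENNReal.tsum_mul_right, mul_assoc]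
  rw [Summable.tsum_finsetSum fun _ _ => ENNReal.summable]

/-- Nonzero entries occur only at stacks with suffix `β`, and `α ↦ α ++ β` is injective, so the sum
can be reindexed by the replacement string. -/
theorem tsum_trans_cons (p : Q) (Z : Γ) (β : List Γ) (v : Q × List Γ → ℝ≥0∞) :
    ∑' t, Δ.trans (p, Z :: β) t * v t = Δ.step p Z fun q α => v (q, α ++ β) := by
  let e : Q × List Γ → Q × List Γ := fun x => (x.1, x.2 ++ β)
  have he : Function.Injective e := by
    rintro ⟨q, α⟩ ⟨q', α'⟩ h
    simpa [e] using h
  rw [← he.tsum_eq]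
  · refine tsum_congr fun x => ?_
    simp [e, trans]
  · rintro ⟨q, γ⟩ h
    have hs : β <:+ γ := by
      by_contra hn
      simp [trans, hn] at h
    obtain ⟨α, rfl⟩ := hs
    exact ⟨(q, α), rfl⟩

theorem nil_mem_emptyStack (p : Q) : (p, []) ∈ emptyStack Q Γ := rfl

theorem applyOff_nil (v : Q × List Γ → ℝ≥0∞) (p : Q) :
    WTS.applyOff Δ.trans (emptyStack Q Γ) v (p, []) = 0 :=
  WTS.applyOff_of_mem _ _ (nil_mem_emptyStack p) _

theorem applyOff_cons (v : Q × List Γ → ℝ≥0∞) (p : Q) (Z : Γ) (β : List Γ) :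
    WTS.applyOff Δ.trans (emptyStack Q Γ) v (p, Z :: β) =
      Δ.step p Z fun q α => v (q, α ++ β) := by
  rw [WTS.applyOff_of_notMem _ _ (by simp [emptyStack]), tsum_trans_cons]

/-- The vector that earns `c` in each configuration with non-empty stack and `b q` in `(q, [])`. -/
def reward (c : ℝ≥0∞) (b : Q → ℝ≥0∞) : Q × List Γ → ℝ≥0∞
  | (q, []) => b q
  | (_, _ :: _) => c

/-- The reward earned in fewer than `n` steps, until the stack is empty. -/
def partialReward (c : ℝ≥0∞) (b : Q → ℝ≥0∞) (n : ℕ) (p : Q) (α : List Γ) : ℝ≥0∞ :=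
  WTS.partialValue Δ.trans (emptyStack Q Γ) (reward c b) n (p, α)

/-- The reward earned until the stack is empty. -/
def totalReward (c : ℝ≥0∞) (b : Q → ℝ≥0∞) (p : Q) (α : List Γ) : ℝ≥0∞ :=
  WTS.value Δ.trans (emptyStack Q Γ) (reward c b) (p, α)

section

variable (c : ℝ≥0∞) (b : Q → ℝ≥0∞)

@[simp] theorem partialReward_zero (p : Q) (α : List Γ) : Δ.partialReward c b 0 p α = 0 :=
  WTS.partialValue_zero ..

@[simp] theorem partialReward_succ_nil (n : ℕ) (p : Q) :
    Δ.partialReward c b (n + 1) p [] = b p := by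
  rw [partialReward, WTS.partialValue_succ, applyOff_nil, add_zero]
  rfl

theorem partialReward_succ_cons (n : ℕ) (p : Q) (Z : Γ) (β : List Γ) :
    Δ.partialReward c b (n + 1) p (Z :: β) =
      c + Δ.step p Z fun q α => Δ.partialReward c b n q (α ++ β) := by
  rw [partialReward, WTS.partialValue_succ, applyOff_cons]
  rfl

theorem partialReward_mono (p : Q) (α : List Γ) : Monotone fun n => Δ.partialReward c b n p α :=
  WTS.partialValue_mono ..

theorem partialReward_le (n : ℕ) (p : Q) (α : List Γ) :
    Δ.partialReward c b n p α ≤ Δ.totalReward c b p α :=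
  WTS.partialValue_le_value ..

theorem tendsto_partialReward (p : Q) (α : List Γ) : Filter.Tendsto
    (fun n => Δ.partialReward c b n p α) Filter.atTop (𝓝 (Δ.totalReward c b p α)) :=
  WTS.tendsto_partialValue ..

@[simp] theorem totalReward_nil (p : Q) : Δ.totalReward c b p [] = b p := by
  rw [totalReward, WTS.value_eq_of_mem _ _ _ (nil_mem_emptyStack p)]
  rfl

theorem totalReward_cons (p : Q) (Z : Γ) (β : List Γ) :
    Δ.totalReward c b p (Z :: β) = c + Δ.step p Z fun q α => Δ.totalReward c b q (α ++ β) := by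
  rw [totalReward, WTS.value_eq, applyOff_cons]
  rfl

theorem totalReward_zero (p : Q) (α : List Γ) : Δ.totalReward 0 0 p α = 0 := by
  refine le_antisymm (WTS.value_le_of_partialValue_le _ _ _ fun n => ?_) zero_le
  induction n generalizing p α with
  | zero => simp
  | succ n ih =>
    cases α with
    | nil => exact (Δ.partialReward_succ_nil 0 0 n p).le
    | cons Z α =>
      refine (Δ.partialReward_succ_cons 0 0 n p Z α).le.trans ?_
      rw [zero_add]
      exact (Δ.step_mono p Z fun q γ => ih q (γ ++ α)).trans (by simp [step])

end

open Classical in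
/-- The probability to reach `(q, [])` from `(p, α)`. -/
def reachProb (p : Q) (α : List Γ) (q : Q) : ℝ≥0∞ := Δ.totalReward 0 (Pi.single q 1) p α

open Classical in
/-- The probability to reach `(q, [])` from `(p, α)` in fewer than `n` steps. -/
def partialReachProb (n : ℕ) (p : Q) (α : List Γ) (q : Q) : ℝ≥0∞ :=
  Δ.partialReward 0 (Pi.single q 1) n p α

/-- The expected time until the stack is empty. -/
def expTime (p : Q) (α : List Γ) : ℝ≥0∞ := Δ.totalReward 1 0 p α

theorem offTarget_emptyStack : WTS.offTarget (emptyStack Q Γ) = reward 1 0 := by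
  funext ⟨q, α⟩
  cases α <;> simp [WTS.offTarget, emptyStack, reward]

theorem onTarget_emptyStack : WTS.onTarget (emptyStack Q Γ) = reward 0 1 := by
  funext ⟨q, α⟩
  cases α <;> simp [WTS.onTarget, emptyStack, reward]

theorem wts_ert_eq (p : Q) (α : List Γ) :
    WTS.ert Δ.trans (emptyStack Q Γ) (p, α) = Δ.expTime p α := by
  rw [WTS.ert_eq_value, offTarget_emptyStack]
  rfl

theorem ert_eq (p : Q) (Z : Γ) : Δ.ert p Z = Δ.expTime p [Z] := Δ.wts_ert_eq p [Z]

theorem termMoment₀_eq (p : Q) (α : List Γ) :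
    WTS.termMoment₀ Δ.trans (emptyStack Q Γ) (p, α) = Δ.totalReward 0 1 p α := by
  rw [WTS.termMoment₀_eq_value, onTarget_emptyStack]
  rfl

variable [Fintype Q]

/-- Granting the full budget `n` to both phases only overcounts. This finite-horizon form drives the
inductions on `n` below. -/
theorem partialReward_append_le (c : ℝ≥0∞) (b : Q → ℝ≥0∞) (n : ℕ) (p : Q) (α β : List Γ) :
    Δ.partialReward c b n p (α ++ β) ≤ Δ.partialReward c 0 n p α +
      ∑ t, Δ.partialReachProb n p α t * Δ.partialReward c b n t β := by
  classical
  induction n generalizing p α with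
  | zero => simp
  | succ n ih =>
    cases α with
    | nil => simp [partialReachProb, Pi.single_apply]
    | cons Z α =>
      rw [List.cons_append, partialReward_succ_cons, partialReward_succ_cons, add_assoc]
      gcongr
      simp only [partialReachProb, partialReward_succ_cons, zero_add]
      rw [← step_sum_mul, ← step_add]
      refine Δ.step_mono p Z fun q γ => ?_
      rw [← List.append_assoc]
      refine (ih q (γ ++ α)).trans ?_
      gcongr with t _
      · exact le_of_eq (by simp only [partialReachProb])
      · exact Δ.partialReward_mono c b t β n.le_succ

/-- Only the first phase is truncated, so the left side counts a part of the full reward; its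
supremum over `n` gives the other half of the splitting. -/
theorem le_totalReward_append (c : ℝ≥0∞) (b : Q → ℝ≥0∞) (n : ℕ) (p : Q) (α β : List Γ) :
    Δ.partialReward c 0 n p α + ∑ t, Δ.partialReachProb n p α t * Δ.totalReward c b t β ≤
      Δ.totalReward c b p (α ++ β) := by
  classical
  induction n generalizing p α with
  | zero => simp [partialReachProb]
  | succ n ih =>
    cases α with
    | nil => simp [partialReachProb, Pi.single_apply]
    | cons Z α =>
      rw [List.cons_append, partialReward_succ_cons, totalReward_cons, add_assoc]
      gcongr
      simp only [partialReachProb, partialReward_succ_cons, zero_add]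
      rw [← step_sum_mul, ← step_add]
      refine Δ.step_mono p Z fun q γ => ?_
      rw [← List.append_assoc]
      refine le_trans (le_of_eq ?_) (ih q (γ ++ α))
      simp only [partialReachProb]

/-- The reward until the stack is empty, split at the first time when `α` has been removed. -/
theorem totalReward_append (c : ℝ≥0∞) (b : Q → ℝ≥0∞) (p : Q) (α β : List Γ) :
    Δ.totalReward c b p (α ++ β) = Δ.totalReward c 0 p α +
      ∑ t, Δ.reachProb p α t * Δ.totalReward c b t β := by
  classical
  refine le_antisymm (le_of_tendsto' (Δ.tendsto_partialReward c b p (α ++ β)) fun n => ?_) ?_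
  · refine (Δ.partialReward_append_le c b n p α β).trans ?_
    gcongr with t _
    · exact Δ.partialReward_le ..
    · exact Δ.partialReward_le ..
    · exact Δ.partialReward_le ..
  · have hmono : ∀ t, Monotone fun n => Δ.partialReachProb n p α t * Δ.totalReward c b t β :=
      fun t m n h => by
        dsimp only
        gcongr
        exact Δ.partialReward_mono _ _ p α h
    have h1 : Δ.totalReward c 0 p α = ⨆ n, Δ.partialReward c 0 n p α :=
      tendsto_nhds_unique (Δ.tendsto_partialReward c 0 p α)
        (tendsto_atTop_iSup (Δ.partialReward_mono c 0 p α))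
    have h2 : ∀ t, Δ.reachProb p α t = ⨆ n, Δ.partialReachProb n p α t := fun t =>
      tendsto_nhds_unique (Δ.tendsto_partialReward _ _ p α)
        (tendsto_atTop_iSup (Δ.partialReward_mono _ _ p α))
    -- All truncations increase with `n`, so one common supremum replaces the separate ones.
    simp only [h1, h2, ENNReal.iSup_mul]
    rw [ENNReal.finsetSum_iSup_of_monotone hmono, ENNReal.iSup_add_iSup_of_monotone
      (Δ.partialReward_mono c 0 p α) (fun m n h => Finset.sum_le_sum fun t _ => hmono t h)]
    exact iSup_le fun n => Δ.le_totalReward_append c b n p α β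

theorem reachProb_append (p : Q) (α β : List Γ) (q : Q) :
    Δ.reachProb p (α ++ β) q = ∑ t, Δ.reachProb p α t * Δ.reachProb t β q := by
  rw [reachProb, totalReward_append, totalReward_zero, zero_add]
  rfl

theorem expTime_append (p : Q) (α β : List Γ) :
    Δ.expTime p (α ++ β) = Δ.expTime p α + ∑ t, Δ.reachProb p α t * Δ.expTime t β := by
  rw [expTime, totalReward_append]
  rfl

theorem termProb_append (p : Q) (α β : List Γ) :
    Δ.totalReward 0 1 p (α ++ β) = ∑ t, Δ.reachProb p α t * Δ.totalReward 0 1 t β := by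
  rw [totalReward_append, totalReward_zero, zero_add]

theorem sum_reachProb (p : Q) (α : List Γ) : ∑ t, Δ.reachProb p α t = Δ.totalReward 0 1 p α := by
  have := Δ.termProb_append p α []
  simpa using this.symm

variable [Fintype Γ]

/-- Strings of length three or more carry weight zero. -/
theorem step_eq_sum (p : Q) (Z : Γ) (g : Q → List Γ → ℝ≥0∞) :
    Δ.step p Z g = ∑ q, (Δ.rweight p Z q [] * g q [] + ∑ Y, Δ.rweight p Z q [Y] * g q [Y]
      + ∑ Y, ∑ X, Δ.rweight p Z q [Y, X] * g q [Y, X]) := by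
  have h3 : ∀ q Y X W (α : List Γ), Δ.rweight p Z q (Y :: X :: W :: α) = 0 := fun q Y X W α => by
    rw [rweight, Δ.weight_eq_zero _ _ _ _ (by simp)]
    simp
  rw [step, ENNReal.tsum_prod (f := fun q α => (Δ.rweight p Z q α : ℝ≥0∞) * g q α), tsum_fintype]
  refine Finset.sum_congr rfl fun q _ => ?_
  rw [ENNReal.tsum_list]
  have h1 : ∀ Y, ∑' α, (Δ.rweight p Z q (Y :: α) : ℝ≥0∞) * g q (Y :: α) =
      Δ.rweight p Z q [Y] * g q [Y] + ∑ X, Δ.rweight p Z q [Y, X] * g q [Y, X] := fun Y => by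
    rw [ENNReal.tsum_list, tsum_fintype]
    congr 1
    refine Finset.sum_congr rfl fun X _ => ?_
    rw [ENNReal.tsum_list]
    simp [h3]
  simp only [tsum_fintype, h1]
  simp [Finset.sum_add_distrib, add_assoc]

end WeightedPDA

/-! ### The fundamental system and the runtime matrix. -/

namespace WeightedPDA

variable {Q Γ : Type*} [Fintype Q] [Fintype Γ] (Δ : WeightedPDA Q Γ)

omit [Fintype Q] [Fintype Γ] in
theorem step_const_mul (p : Q) (Z : Γ) (k : ℝ≥0∞) (g : Q → List Γ → ℝ≥0∞) :
    Δ.step p Z (fun q α => k * g q α) = k * Δ.step p Z g := by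
  simp only [step, ← ENNReal.tsum_mul_left, mul_left_comm k]

theorem step_mono_of_short (p : Q) (Z : Γ) {g h : Q → List Γ → ℝ≥0∞}
    (h₀ : ∀ q, g q [] ≤ h q []) (h₁ : ∀ q Y, g q [Y] ≤ h q [Y])
    (h₂ : ∀ q Y X, g q [Y, X] ≤ h q [Y, X]) : Δ.step p Z g ≤ Δ.step p Z h := by
  rw [step_eq_sum, step_eq_sum]
  gcongr with q _ Y _ Y _ X _
  · exact h₀ q
  · exact h₁ q Y
  · exact h₂ q Y X

open Classical in
/-- The probabilities to remove a string of length at most two, computed from those for single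
symbols. -/
def popProb (u : Q × Γ × Q → ℝ≥0∞) (q : Q) : Q → List Γ → ℝ≥0∞
  | r, [] => (Pi.single q 1 : Q → ℝ≥0∞) r
  | r, [Y] => u (r, Y, q)
  | r, [Y, W] => ∑ t, u (r, Y, t) * u (t, W, q)
  | _, _ => 0

theorem fundamentalPPS_apply (u : Q × Γ × Q → ℝ≥0∞) (p : Q) (Z : Γ) (q : Q) :
    Δ.fundamentalPPS.toOrderHom u (p, Z, q) = Δ.step p Z (popProb u q) := by
  classical
  rw [step_eq_sum]
  simp [PPS.toOrderHom, fundamentalPPS, popProb, Pi.single_apply, Finset.sum_add_distrib,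
    show ∀ x, algebraMap ℝ≥0 ℝ≥0∞ x = x from fun _ => rfl]

omit [Fintype Q] [Fintype Γ] in
theorem partialReachProb_succ (n : ℕ) (p : Q) (Z : Γ) (q : Q) :
    Δ.partialReachProb (n + 1) p [Z] q = Δ.step p Z fun r α => Δ.partialReachProb n r α q := by
  rw [partialReachProb, partialReward_succ_cons, zero_add]
  simp only [List.append_nil, partialReachProb]

omit [Fintype Q] [Fintype Γ] in
theorem reachProb_eq_step (p : Q) (Z : Γ) (q : Q) :
    Δ.reachProb p [Z] q = Δ.step p Z fun r α => Δ.reachProb r α q := by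
  rw [reachProb, totalReward_cons, zero_add]
  simp only [List.append_nil, reachProb]

/-- Induction on the horizon: unfold the fixed point once and split a pushed pair of symbols by
`partialReward_append_le`, whose running reward vanishes here. -/
theorem partialReachProb_le_lfp (n : ℕ) (p : Q) (Z : Γ) (q : Q) :
    Δ.partialReachProb n p [Z] q ≤ Δ.fundamentalPPS.lfp (p, Z, q) := by
  classical
  induction n generalizing p Z q with
  | zero => simp [partialReachProb]
  | succ n ih =>
    rw [PPS.lfp, ← OrderHom.map_lfp, fundamentalPPS_apply, partialReachProb_succ]
    refine Δ.step_mono_of_short p Z (fun r => ?_) (fun r Y => ih r Y q) fun r Y W => ?_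
    · refine (Δ.partialReward_le ..).trans ?_
      rw [totalReward_nil]
      exact le_of_eq (by simp only [popProb])
    · refine (Δ.partialReward_append_le _ _ n r [Y] [W]).trans ?_
      refine (add_le_of_nonpos_left ?_).trans
        (Finset.sum_le_sum fun t _ => mul_le_mul' (ih r Y t) (ih t W q))
      exact (Δ.partialReward_le ..).trans (Δ.totalReward_zero ..).le

/-- The pop probabilities form a pre-fixed point by `reachProb_append`, hence dominate the least
one; conversely, all their truncations lie below it. -/
theorem lfp_fundamentalPPS (p : Q) (Z : Γ) (q : Q) :
    Δ.fundamentalPPS.lfp (p, Z, q) = Δ.reachProb p [Z] q := by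
  classical
  refine le_antisymm ?_ (le_of_tendsto' (Δ.tendsto_partialReward _ _ p [Z]) fun n =>
    Δ.partialReachProb_le_lfp n p Z q)
  refine OrderHom.lfp_le Δ.fundamentalPPS.toOrderHom (a := fun x => Δ.reachProb x.1 [x.2.1] x.2.2)
    ?_ (p, Z, q)
  rintro ⟨p, Z, q⟩
  rw [fundamentalPPS_apply]
  refine le_of_le_of_eq ?_ (Δ.reachProb_eq_step p Z q).symm
  refine Δ.step_mono_of_short p Z (fun r => ?_) (fun r Y => le_rfl) fun r Y W => ?_
  · rw [reachProb, totalReward_nil]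
    exact le_of_eq (by simp only [popProb])
  · exact (Δ.reachProb_append r [Y] [W] q).ge

/-- The expected times to remove a string of length at most two, computed from those for single
symbols. -/
def popTime (u : Q × Γ × Q → ℝ≥0∞) (x : Q × Γ → ℝ≥0∞) : Q → List Γ → ℝ≥0∞
  | _, [] => 0
  | q, [Y] => x (q, Y)
  | q, [Y, W] => x (q, Y) + ∑ t, u (q, Y, t) * x (t, W)
  | _, _ => 0

theorem ertMatrix_mulVec (u : Q × Γ × Q → ℝ≥0∞) (x : Q × Γ → ℝ≥0∞) (p : Q) (Z : Γ) :
    (Δ.ertMatrix u).mulVec x (p, Z) = Δ.step p Z (popTime u x) := by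
  rw [step_eq_sum, Matrix.mulVec, dotProduct, Fintype.sum_prod_type]
  simp only [ertMatrix, Matrix.of_apply, popTime, add_mul, Finset.sum_add_distrib, mul_add,
    mul_zero, zero_add, add_assoc, Finset.sum_mul]
  congr 2
  simp only [Finset.mul_sum, mul_assoc]
  -- The matrix groups terms by variable, `step` by transition; only the order of summation differs.
  rw [Finset.sum_comm, Finset.sum_congr rfl fun _ _ => Finset.sum_comm, Finset.sum_comm]
  refine Finset.sum_congr rfl fun r _ => ?_
  rw [Finset.sum_congr rfl fun _ _ => Finset.sum_comm, Finset.sum_comm]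

theorem isErtBound_iff (u : Q × Γ × Q → ℝ≥0∞) (r : Q × Γ → ℝ≥0) :
    Δ.IsErtBound u r ↔ ∀ p Z, Δ.step p Z (popTime u fun x => r x) + 1 ≤ r (p, Z) := by
  simp only [IsErtBound, Pi.le_def, Prod.forall, Pi.add_apply, ertMatrix_mulVec, Pi.one_apply]

omit [Fintype Q] [Fintype Γ] in
theorem expTime_eq_step (p : Q) (Z : Γ) :
    Δ.expTime p [Z] = 1 + Δ.step p Z Δ.expTime := by
  rw [expTime, totalReward_cons]
  simp only [List.append_nil]
  rfl

theorem step_popTime_add_one (p : Q) (Z : Γ) :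
    Δ.step p Z (popTime Δ.fundamentalPPS.lfp fun x => Δ.expTime x.1 [x.2]) + 1 =
      Δ.expTime p [Z] := by
  rw [expTime_eq_step, add_comm]
  congr 1
  rw [step_eq_sum, step_eq_sum]
  have h0 : ∀ q, Δ.expTime q [] = 0 := fun q => Δ.totalReward_nil 1 0 q
  have h2 : ∀ q Y X, Δ.expTime q [Y, X] =
      Δ.expTime q [Y] + ∑ t, Δ.reachProb q [Y] t * Δ.expTime t [X] :=
    fun q Y X => Δ.expTime_append q [Y] [X]
  simp only [popTime, lfp_fundamentalPPS, h0, h2]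

/-- Truncated times obey the linear system as an inequality with truncated pop probabilities, which
lie below `μf ≤ u`; induction on the horizon then uses only that `r` is a pre-solution. -/
theorem expTime_le_of_isErtBound {u : Q × Γ × Q → ℝ≥0∞} (hu : Δ.fundamentalPPS.lfp ≤ u)
    {r : Q × Γ → ℝ≥0} (hr : Δ.IsErtBound u r) (p : Q) (Z : Γ) : Δ.expTime p [Z] ≤ r (p, Z) := by
  rw [isErtBound_iff] at hr
  refine le_of_tendsto' (Δ.tendsto_partialReward 1 0 p [Z]) fun n => ?_
  induction n generalizing p Z with
  | zero => simp
  | succ n ih =>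
    rw [partialReward_succ_cons, add_comm]
    refine le_trans ?_ (hr p Z)
    gcongr
    simp only [List.append_nil]
    refine Δ.step_mono_of_short p Z (fun q => ?_) (fun q Y => ih q Y) fun q Y W => ?_
    · exact (Δ.partialReward_le ..).trans (Δ.totalReward_nil 1 0 q).le
    · refine (Δ.partialReward_append_le 1 0 n q [Y] [W]).trans ?_
      exact add_le_add (ih q Y) (Finset.sum_le_sum fun t _ =>
        mul_le_mul' ((Δ.partialReachProb_le_lfp n q Y t).trans (hu _)) (ih t W))

omit [Fintype Q] [Fintype Γ] in
theorem past_iff : Δ.PAST ↔ ∀ p α, Δ.expTime p α < ∞ := by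
  simp only [PAST, WTS.PAST, Prod.forall, wts_ert_eq]

omit [Fintype Γ] in
theorem ast_iff : Δ.AST ↔ ∀ p α, ∑ t, Δ.reachProb p α t = 1 := by
  simp only [AST, WTS.AST, Prod.forall, termMoment₀_eq, sum_reachProb]

/-- Termination from single symbols extends to all stacks by popping one symbol at a time. -/
theorem ast_iff_sum_lfp : Δ.AST ↔ ∀ p Z, ∑ t, Δ.fundamentalPPS.lfp (p, Z, t) = 1 := by
  simp only [lfp_fundamentalPPS, ast_iff]
  refine ⟨fun h p Z => h p [Z], fun h p α => ?_⟩
  induction α generalizing p with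
  | nil => rw [sum_reachProb, totalReward_nil]; rfl
  | cons Z α ih =>
    have := Δ.termProb_append p [Z] α
    simp only [← sum_reachProb, ih, mul_one, h] at this
    exact this

/-! ### Soundness and completeness of the two reports. -/

variable {Δ} (hΔ : Δ.IsProbabilistic)
include hΔ

theorem tsum_trans_eq_one (s : Q × List Γ) (hs : s ∉ emptyStack Q Γ) : ∑' t, Δ.trans s t = 1 := by
  obtain ⟨p, _ | ⟨Z, β⟩⟩ := s
  · exact absurd (nil_mem_emptyStack p) hs
  have := Δ.tsum_trans_cons p Z β 1
  simp only [Pi.one_apply, mul_one] at this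
  rw [this, step_eq_sum]
  have h1 : ∑ q, (Δ.rweight p Z q [] + ∑ Y, Δ.rweight p Z q [Y]
      + ∑ Y, ∑ X, Δ.rweight p Z q [Y, X]) = 1 := by
    simp only [rweight]
    exact_mod_cast hΔ p Z
  simp only [mul_one]
  exact_mod_cast h1

theorem IsProbabilistic.ast_of_past (h : Δ.PAST) : Δ.AST :=
  WTS.PAST.ast (tsum_trans_eq_one hΔ) h

theorem sum_reachProb_le_one (p : Q) (α : List Γ) : ∑ t, Δ.reachProb p α t ≤ 1 := by
  rw [sum_reachProb, ← termMoment₀_eq]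
  exact WTS.termMoment₀_le_one (tsum_trans_eq_one hΔ) _

theorem past_of_isErtBound {u : Q × Γ × Q → ℝ≥0∞} (hu : Δ.fundamentalPPS.lfp ≤ u)
    {r : Q × Γ → ℝ≥0} (hr : Δ.IsErtBound u r) : Δ.PAST := by
  rw [past_iff]
  intro p α
  induction α generalizing p with
  | nil => rw [expTime, totalReward_nil]; exact ENNReal.zero_lt_top
  | cons Z α ih =>
    have := Δ.expTime_append p [Z] α
    rw [List.singleton_append] at this
    rw [this]
    refine ENNReal.add_lt_top.2 ⟨(Δ.expTime_le_of_isErtBound hu hr p Z).trans_lt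
      ENNReal.coe_lt_top, ENNReal.sum_lt_top.2 fun t _ => ENNReal.mul_lt_top ?_ (ih t)⟩
    refine lt_of_le_of_lt ?_ ENNReal.one_lt_top
    exact (Finset.single_le_sum (fun _ _ => zero_le) (Finset.mem_univ t)).trans
      (sum_reachProb_le_one hΔ p [Z])

omit hΔ in
theorem not_ast_of_sum_lt_one {u : Q × Γ × Q → ℝ≥0∞} (hu : Δ.fundamentalPPS.lfp ≤ u)
    {p : Q} {Z : Γ} (h : ∑ t, u (p, Z, t) < 1) : ¬ Δ.AST := fun hA =>
  (((ast_iff_sum_lfp Δ).1 hA p Z).symm.trans_le (Finset.sum_le_sum fun _ _ => hu _)).not_gt h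

omit hΔ in
theorem exists_isErtBound_natCast (h : Δ.PAST) {u : ℕ → Q × Γ × Q → ℝ≥0∞}
    (hu : Δ.IsUpperScheme u) : ∃ i, ∃ ρ : Q × Γ → ℕ, Δ.IsErtBound (u i) fun x => (ρ x : ℝ≥0) := by
  rw [past_iff] at h
  let e : Q × Γ → ℝ≥0 := fun x => (Δ.expTime x.1 [x.2]).toNNReal
  have he : ∀ x : Q × Γ, (e x : ℝ≥0∞) = Δ.expTime x.1 [x.2] := fun x =>
    ENNReal.coe_toNNReal (h _ _).ne
  -- Scaling by `3` turns the `+ 1` of the system into `+ 3`: one unit pays for rounding down, one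
  -- for the required `+ 1`, and one for the error in `u i`.
  let ρ : Q × Γ → ℕ := fun x => ⌊3 * e x⌋₊
  have hle : ∀ x, ((ρ x : ℝ≥0) : ℝ≥0∞) ≤ 3 * Δ.expTime x.1 [x.2] := fun x => by
    rw [← he]
    exact_mod_cast Nat.floor_le (zero_le (a := 3 * e x))
  have hge : ∀ x, 3 * Δ.expTime x.1 [x.2] ≤ ((ρ x : ℝ≥0) : ℝ≥0∞) + 1 := fun x => by
    rw [← he]
    exact_mod_cast (Nat.lt_floor_add_one (3 * e x)).le
  let L : Q × Γ → ℝ≥0∞ := fun x => Δ.step x.1 x.2 (popTime Δ.fundamentalPPS.lfp fun x => (ρ x : ℝ≥0))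
  have hL : ∀ x, L x + 2 ≤ (ρ x : ℝ≥0) := fun x => by
    have h1 : L x ≤ 3 * Δ.step x.1 x.2
        (popTime Δ.fundamentalPPS.lfp fun x => Δ.expTime x.1 [x.2]) := by
      rw [← step_const_mul]
      refine Δ.step_mono_of_short _ _ (fun q => ?_) (fun q Y => hle (q, Y)) fun q Y X => ?_
      · simp [popTime]
      · simp only [popTime, mul_add, Finset.mul_sum]
        refine add_le_add (hle (q, Y)) (Finset.sum_le_sum fun t _ => ?_)
        rw [mul_left_comm]
        gcongr
        exact hle (t, X)
    refine (ENNReal.add_le_add_iff_right ENNReal.one_ne_top).1 ?_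
    refine le_trans ?_ (hge x)
    rw [← step_popTime_add_one, mul_add, mul_one, add_assoc]
    exact add_le_add h1 (by norm_num)
  have hlim : ∀ x : Q × Γ, Filter.Tendsto
      (fun i => Δ.step x.1 x.2 (popTime (u i) fun x => (ρ x : ℝ≥0))) Filter.atTop (𝓝 (L x)) := by
    intro x
    have hu' := fun y => tendsto_pi_nhds.1 hu.2.2 y
    simp only [L, step_eq_sum, popTime]
    refine tendsto_finsetSum _ fun q _ => Filter.Tendsto.add tendsto_const_nhds
      (tendsto_finsetSum _ fun Y _ => tendsto_finsetSum _ fun X _ => ?_)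
    refine ENNReal.Tendsto.const_mul ?_ (Or.inr ENNReal.coe_ne_top)
    refine tendsto_const_nhds.add (tendsto_finsetSum _ fun t _ => ?_)
    exact ENNReal.Tendsto.mul_const (hu' _) (Or.inr ENNReal.coe_ne_top)
  have hev : ∀ᶠ i in Filter.atTop, ∀ x : Q × Γ,
      Δ.step x.1 x.2 (popTime (u i) fun x => (ρ x : ℝ≥0)) < L x + 1 := by
    -- There are finitely many inequalities, so one round serves all of them; `L x < L x + 1` needs
    -- `L x` finite, which follows from `hL`.
    refine Filter.eventually_all.2 fun x => (hlim x).eventually_lt_const ?_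
    refine ENNReal.lt_add_right ?_ one_ne_zero
    exact ne_top_of_le_ne_top ENNReal.coe_ne_top (le_self_add.trans (hL x))
  obtain ⟨i, hi⟩ := hev.exists
  refine ⟨i, ρ, (Δ.isErtBound_iff _ _).2 fun p Z => ?_⟩
  calc _ ≤ L (p, Z) + 1 + 1 := by gcongr; exact (hi (p, Z)).le
    _ = L (p, Z) + 2 := by rw [add_assoc, one_add_one_eq_two]
    _ ≤ _ := hL (p, Z)

theorem exists_sum_lt_one (h : ¬ Δ.AST) {u : ℕ → Q × Γ × Q → ℝ≥0∞} (hu : Δ.IsUpperScheme u) :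
    ∃ i p Z, ∑ t, u i (p, Z, t) < 1 := by
  rw [ast_iff_sum_lfp] at h
  push Not at h
  obtain ⟨p, Z, hne⟩ := h
  have hlt : ∑ t, Δ.fundamentalPPS.lfp (p, Z, t) < 1 := by
    refine lt_of_le_of_ne ?_ hne
    simp only [lfp_fundamentalPPS]
    exact sum_reachProb_le_one hΔ p [Z]
  have hlim : Filter.Tendsto (fun i => ∑ t, u i (p, Z, t)) Filter.atTop
      (𝓝 (∑ t, Δ.fundamentalPPS.lfp (p, Z, t))) :=
    tendsto_finsetSum _ fun t _ => tendsto_pi_nhds.1 hu.2.2 _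
  obtain ⟨i, hi⟩ := (hlim.eventually_lt_const hlt).exists
  exact ⟨i, p, Z, hi⟩

/-- With sound reports it suffices that some report is made: the opposite answer is excluded because
PAST implies AST. Hence the order of the search is immaterial, and the abstract procedure and the
computable one share this lemma. -/
theorem decidesTermination_rfindOpt {V : ℕ → Option Bool} (ht : ∀ i, V i = some true → Δ.PAST)
    (hf : ∀ i, V i = some false → ¬ Δ.AST) (hp : Δ.PAST → ∃ i, (V i).isSome)
    (hn : ¬ Δ.AST → ∃ i, (V i).isSome) : DecidesTermination Δ (Nat.rfindOpt V) := by
  have key : ∀ b, b ∈ Nat.rfindOpt V → ∃ i, V i = some b := fun b hb => Nat.rfindOpt_spec hb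
  have dom : (∃ i, (V i).isSome) → ∃ b, b ∈ Nat.rfindOpt V := fun ⟨i, hi⟩ =>
    Part.dom_iff_mem.1 (Nat.rfindOpt_dom.2 ⟨i, Option.isSome_iff_exists.1 hi⟩)
  refine ⟨⟨fun h => ?_, fun h => ?_⟩, fun h => ?_, fun h => ?_⟩
  · obtain ⟨i, hi⟩ := key _ h
    exact ht i hi
  · obtain ⟨_ | _, hb⟩ := dom (hp h)
    · obtain ⟨i, hi⟩ := key _ hb
      exact absurd (hΔ.ast_of_past h) (hf i hi)
    · exact hb
  · obtain ⟨i, hi⟩ := key _ h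
    exact hf i hi
  · obtain ⟨_ | _, hb⟩ := dom (hn h)
    · exact hb
    · obtain ⟨i, hi⟩ := key _ hb
      exact absurd (hΔ.ast_of_past (ht i hi)) h

theorem decidesTermination_semiAlgorithm {u : ℕ → Q × Γ × Q → ℝ≥0∞} (hu : Δ.IsUpperScheme u) :
    DecidesTermination Δ (Δ.semiAlgorithm u) := by
  classical
  refine decidesTermination_rfindOpt hΔ (fun i hi => ?_) (fun i hi => ?_) (fun h => ?_) fun h => ?_
  · unfold verdict at hi
    split_ifs at hi with h1 h2 <;> simp at hi
    obtain ⟨r, hr⟩ := h1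
    exact past_of_isErtBound hΔ (hu.2.1 i) hr
  · unfold verdict at hi
    split_ifs at hi with h1 h2 <;> simp at hi
    obtain ⟨p, Z, h⟩ := h2
    exact not_ast_of_sum_lt_one (hu.2.1 i) h
  · obtain ⟨i, ρ, h⟩ := exists_isErtBound_natCast h hu
    refine ⟨i, ?_⟩
    rw [verdict, if_pos ⟨_, h⟩]
    rfl
  · obtain ⟨i, h⟩ := exists_sum_lt_one hΔ h hu
    refine ⟨i, ?_⟩
    rw [verdict]
    split_ifs <;> rfl

end WeightedPDA

/-! ### Computable arithmetic on fractions. -/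

/-- `f` is computed by a computable function into fractions. -/
def IsComputableFrac {α : Type*} [Primcodable α] (f : α → ℚ≥0) : Prop :=
  ∃ g : α → ℕ × ℕ, Computable g ∧ ∀ a, fracVal (g a) = f a

/-- The sum of two fractions. -/
def fracAdd (x y : ℕ × ℕ) : ℕ × ℕ :=
  (x.1 * (y.2 + 1) + y.1 * (x.2 + 1), (x.2 + 1) * (y.2 + 1) - 1)

/-- The product of two fractions. -/
def fracMul (x y : ℕ × ℕ) : ℕ × ℕ := (x.1 * y.1, (x.2 + 1) * (y.2 + 1) - 1)

theorem fracVal_fracAdd (x y : ℕ × ℕ) : fracVal (fracAdd x y) = fracVal x + fracVal y := by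
  -- Denominators are stored minus one; the product is positive, so the subtraction does not
  -- truncate.
  have h : (((x.2 + 1) * (y.2 + 1) - 1 : ℕ) : ℚ≥0) + 1 = (x.2 + 1) * (y.2 + 1) := by
    rw [← Nat.cast_add_one, Nat.sub_add_cancel (Nat.succ_le_of_lt (by positivity))]
    push_cast
    rfl
  simp only [fracVal, fracAdd, h]
  rw [div_add_div _ _ (by positivity) (by positivity)]
  push_cast
  ring

theorem fracVal_fracMul (x y : ℕ × ℕ) : fracVal (fracMul x y) = fracVal x * fracVal y := by
  have h : (((x.2 + 1) * (y.2 + 1) - 1 : ℕ) : ℚ≥0) + 1 = (x.2 + 1) * (y.2 + 1) := by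
    rw [← Nat.cast_add_one, Nat.sub_add_cancel (Nat.succ_le_of_lt (by positivity))]
    push_cast
    rfl
  simp only [fracVal, fracMul, h]
  rw [div_mul_div_comm]
  push_cast
  rfl

theorem fracVal_le_iff (x y : ℕ × ℕ) :
    fracVal x ≤ fracVal y ↔ x.1 * (y.2 + 1) ≤ y.1 * (x.2 + 1) := by
  rw [fracVal, fracVal, div_le_div_iff₀ (by positivity) (by positivity)]
  norm_cast

theorem fracVal_eq_zero_iff (x : ℕ × ℕ) : fracVal x = 0 ↔ x.1 = 0 := by
  have : ((x.2 : ℚ≥0) + 1) ≠ 0 := by positivity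
  simp [fracVal, this]

theorem primrec_fracAdd : Primrec₂ fracAdd := by
  have a := Primrec.fst.comp (Primrec.fst (α := ℕ × ℕ) (β := ℕ × ℕ))
  have b := Primrec.succ.comp (Primrec.snd.comp (Primrec.fst (α := ℕ × ℕ) (β := ℕ × ℕ)))
  have c := Primrec.fst.comp (Primrec.snd (α := ℕ × ℕ) (β := ℕ × ℕ))
  have d := Primrec.succ.comp (Primrec.snd.comp (Primrec.snd (α := ℕ × ℕ) (β := ℕ × ℕ)))
  exact (Primrec.nat_add.comp (Primrec.nat_mul.comp a d) (Primrec.nat_mul.comp c b)).pair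
    (Primrec.pred.comp (Primrec.nat_mul.comp b d))

theorem primrec_fracMul : Primrec₂ fracMul := by
  have a := Primrec.fst.comp (Primrec.fst (α := ℕ × ℕ) (β := ℕ × ℕ))
  have b := Primrec.succ.comp (Primrec.snd.comp (Primrec.fst (α := ℕ × ℕ) (β := ℕ × ℕ)))
  have c := Primrec.fst.comp (Primrec.snd (α := ℕ × ℕ) (β := ℕ × ℕ))
  have d := Primrec.succ.comp (Primrec.snd.comp (Primrec.snd (α := ℕ × ℕ) (β := ℕ × ℕ)))
  exact (Primrec.nat_mul.comp a c).pair (Primrec.pred.comp (Primrec.nat_mul.comp b d))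

theorem primrec_fracLe :
    Primrec₂ fun x y : ℕ × ℕ => if x.1 * (y.2 + 1) ≤ y.1 * (x.2 + 1) then (0, 0) else (1, 0) := by
  have a := Primrec.fst.comp (Primrec.fst (α := ℕ × ℕ) (β := ℕ × ℕ))
  have b := Primrec.succ.comp (Primrec.snd.comp (Primrec.fst (α := ℕ × ℕ) (β := ℕ × ℕ)))
  have c := Primrec.fst.comp (Primrec.snd (α := ℕ × ℕ) (β := ℕ × ℕ))
  have d := Primrec.succ.comp (Primrec.snd.comp (Primrec.snd (α := ℕ × ℕ) (β := ℕ × ℕ)))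
  exact Primrec.ite (Primrec.nat_le.comp (Primrec.nat_mul.comp a d) (Primrec.nat_mul.comp c b))
    (Primrec.const (0, 0)) (Primrec.const (1, 0))

namespace IsComputableFrac

variable {α β : Type*} [Primcodable α] [Primcodable β] {f g : α → ℚ≥0}

theorem comp (hf : IsComputableFrac f) {h : β → α} (hh : Computable h) :
    IsComputableFrac fun b => f (h b) := by
  obtain ⟨F, hF, hfF⟩ := hf
  exact ⟨fun b => F (h b), hF.comp hh, fun b => hfF _⟩

theorem natCast {h : α → ℕ} (hh : Computable h) : IsComputableFrac fun a => (h a : ℚ≥0) :=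
  ⟨fun a => (h a, 0), hh.pair (Computable.const 0), fun a => by simp [fracVal]⟩

theorem one : IsComputableFrac fun _ : α => (1 : ℚ≥0) := by
  simpa using natCast (α := α) (Computable.const 1)

theorem fracVal {h : α → ℕ × ℕ} (hh : Computable h) : IsComputableFrac fun a => fracVal (h a) :=
  ⟨h, hh, fun _ => rfl⟩

theorem add (hf : IsComputableFrac f) (hg : IsComputableFrac g) :
    IsComputableFrac fun a => f a + g a := by
  obtain ⟨F, hF, hfF⟩ := hf
  obtain ⟨G, hG, hgG⟩ := hg
  exact ⟨fun a => fracAdd (F a) (G a), primrec_fracAdd.to_comp.comp hF hG,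
    fun a => by rw [fracVal_fracAdd, hfF, hgG]⟩

theorem mul (hf : IsComputableFrac f) (hg : IsComputableFrac g) :
    IsComputableFrac fun a => f a * g a := by
  obtain ⟨F, hF, hfF⟩ := hf
  obtain ⟨G, hG, hgG⟩ := hg
  exact ⟨fun a => fracMul (F a) (G a), primrec_fracMul.to_comp.comp hF hG,
    fun a => by rw [fracVal_fracMul, hfF, hgG]⟩

/-- A failed comparison is coded as the number `1`, so a bounded universal statement becomes the
vanishing of a finite sum. -/
theorem indicator_not_le (hf : IsComputableFrac f) (hg : IsComputableFrac g) :
    IsComputableFrac fun a => if f a ≤ g a then 0 else 1 := by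
  obtain ⟨F, hF, hfF⟩ := hf
  obtain ⟨G, hG, hgG⟩ := hg
  refine ⟨_, primrec_fracLe.to_comp.comp hF hG, fun a => ?_⟩
  simp only [← hfF, ← hgG, fracVal_le_iff]
  split_ifs <;> simp [_root_.fracVal]

theorem sum_range {f : α → ℕ → ℚ≥0} (hf : IsComputableFrac fun x : α × ℕ => f x.1 x.2)
    {n : α → ℕ} (hn : Computable n) :
    IsComputableFrac fun a => ∑ i ∈ Finset.range (n a), f a i := by
  obtain ⟨F, hF, hfF⟩ := hf
  have hstep : Computable₂ fun (a : α) (p : ℕ × (ℕ × ℕ)) => fracAdd p.2 (F (a, p.1)) :=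
    primrec_fracAdd.to_comp.comp (Computable.snd.comp Computable.snd)
      (hF.comp (Computable.fst.pair (Computable.fst.comp Computable.snd)))
  refine ⟨_, Computable.nat_rec hn (Computable.const (0, 0)) hstep, fun a => ?_⟩
  dsimp only
  induction n a with
  | zero => simp [_root_.fracVal]
  | succ k ih => rw [Finset.sum_range_succ, ← ih, show f a k = _ from (hfF (a, k)).symm,
      ← fracVal_fracAdd]

theorem computable_decide_eq_zero (hf : IsComputableFrac f) :
    Computable fun a => decide (f a = 0) := by
  obtain ⟨F, hF, hfF⟩ := hf
  have : Primrec fun x : ℕ => decide (x = 0) :=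
    (Primrec.eq.comp Primrec.id (Primrec.const 0)).decide
  refine (this.to_comp.comp (Computable.fst.comp hF)).of_eq fun a => ?_
  rw [← hfF a]
  simp only [fracVal_eq_zero_iff]

end IsComputableFrac

/-! ### Checking certificates on codes of automata. -/

/-- The weights described by a code, with natural numbers for states and symbols. -/
def PDACode.natWeight (c : PDACode) (p Z q : ℕ) (α : List ℕ) : ℚ≥0 :=
  ((c.2.2.filter fun e => e.1 = (p, Z, q, α)).map fun e => fracVal e.2).sum

theorem isComputableFrac_natWeight : IsComputableFrac
    fun x : PDACode × ℕ × ℕ × ℕ × List ℕ => x.1.natWeight x.2.1 x.2.2.1 x.2.2.2.1 x.2.2.2.2 := by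
  let E := (ℕ × ℕ × ℕ × List ℕ) × (ℕ × ℕ)
  let h : PDACode × ℕ × ℕ × ℕ × List ℕ → E × (ℕ × ℕ) → ℕ × ℕ := fun x p =>
    if p.1.1 = x.2 then fracAdd p.1.2 p.2 else p.2
  have hh : Primrec₂ h := by
    refine Primrec.ite (Primrec.eq.comp
      (Primrec.fst.comp (Primrec.fst.comp Primrec.snd)) (Primrec.snd.comp Primrec.fst)) ?_
      (Primrec.snd.comp Primrec.snd)
    exact primrec_fracAdd.comp (Primrec.snd.comp (Primrec.fst.comp Primrec.snd))
      (Primrec.snd.comp Primrec.snd)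
  have hL : Primrec fun x : PDACode × ℕ × ℕ × ℕ × List ℕ => x.1.2.2 :=
    Primrec.snd.comp (Primrec.snd.comp Primrec.fst)
  refine ⟨_, (Primrec.list_foldr hL (Primrec.const (0, 0)) hh).to_comp, ?_⟩
  rintro ⟨⟨n, m, L⟩, y⟩
  simp only [PDACode.natWeight]
  induction L with
  | nil => simp [fracVal]
  | cons e L ih =>
    rw [List.foldr_cons]
    by_cases he : e.1 = y
    · simp only [h, he, if_true, fracVal_fracAdd]
      simp only [h] at ih
      rw [ih]
      simp [he]
    · simp only [h, he, if_false]
      simp only [h] at ih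
      rw [ih]
      simp [he]

namespace PDACode

theorem toPDA_weight (c : PDACode) (p : Fin c.1) (Z : Fin c.2.1) (q : Fin c.1)
    (α : List (Fin c.2.1)) (hα : α.length ≤ 2) :
    c.toPDA.weight p Z q α = c.natWeight p Z q (α.map Fin.val) := by
  simp [toPDA, natWeight, hα]

/-- The entry at `(p, Z)` of a vector stored in a list. -/
def entry (l : List ℕ) (p Z : ℕ) : ℕ := l[Nat.pair p Z]?.getD 0

/-- `Nat.pair` is strictly increasing in both arguments, so length `Nat.pair n m` leaves room for
every index. Lists thus give one type of candidates for automata of all sizes. -/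
theorem exists_entry_eq {n m : ℕ} (ρ : Fin n × Fin m → ℕ) :
    ∃ l : List ℕ, ∀ x : Fin n × Fin m, entry l x.1 x.2 = ρ x := by
  let g : ℕ → ℕ := fun j =>
    if h : j.unpair.1 < n ∧ j.unpair.2 < m then ρ (⟨j.unpair.1, h.1⟩, ⟨j.unpair.2, h.2⟩) else 0
  refine ⟨(List.range (Nat.pair n m)).map g, fun ⟨p, Z⟩ => ?_⟩
  have hlt : Nat.pair p Z < Nat.pair n m :=
    (Nat.pair_lt_pair_left _ p.2).trans (Nat.pair_lt_pair_right _ Z.2)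
  simp [entry, hlt, g]

variable (U : PDACode × ℕ × ℕ × ℕ × ℕ → ℕ × ℕ) (c : PDACode) (i : ℕ) (l : List ℕ)

/-- The left-hand side of the linear inequality for `(p, Z)`. -/
def boundLhs (p Z : ℕ) : ℚ≥0 :=
  (∑ s ∈ Finset.range c.1, ∑ V ∈ Finset.range c.2.1, (c.natWeight p Z s [V] * entry l s V +
    ∑ W ∈ Finset.range c.2.1, c.natWeight p Z s [V, W] * (entry l s V +
      ∑ t ∈ Finset.range c.1, fracVal (U (c, i, s, V, t)) * entry l t W))) + 1

/-- The number of violated linear inequalities. -/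
def boundViolations : ℚ≥0 :=
  ∑ p ∈ Finset.range c.1, ∑ Z ∈ Finset.range c.2.1,
    if boundLhs U c i l p Z ≤ entry l p Z then 0 else 1

/-- The number of indices `(p, Z)` with a row sum less than one. -/
def deficientRows : ℚ≥0 :=
  ∑ p ∈ Finset.range c.1, ∑ Z ∈ Finset.range c.2.1,
    if 1 ≤ ∑ t ∈ Finset.range c.1, fracVal (U (c, i, p, Z, t)) then 0 else 1

theorem boundViolations_eq_zero_iff : boundViolations U c i l = 0 ↔
    c.toPDA.IsErtBound (schemeSeq U c i) fun x => (entry l x.1 x.2 : ℝ≥0) := by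
  have key : ∀ (p : Fin c.1) (Z : Fin c.2.1), c.toPDA.step p Z
      (WeightedPDA.popTime (schemeSeq U c i) fun x => ((entry l x.1 x.2 : ℝ≥0) : ℝ≥0∞)) + 1 =
      ((boundLhs U c i l p Z : ℝ≥0) : ℝ≥0∞) := by
    intro p Z
    have h1 : ∀ s V, c.toPDA.weight p Z s [V] = c.natWeight p Z s [(V : ℕ)] :=
      fun s V => c.toPDA_weight p Z s [V] (by simp)
    have h2 : ∀ s V W, c.toPDA.weight p Z s [V, W] = c.natWeight p Z s [(V : ℕ), (W : ℕ)] :=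
      fun s V W => c.toPDA_weight p Z s [V, W] (by simp)
    rw [WeightedPDA.step_eq_sum]
    simp only [WeightedPDA.rweight, h1, h2, boundLhs, Finset.sum_range, WeightedPDA.popTime,
      schemeSeq, mul_zero, zero_add]
    push_cast
    simp only [Finset.sum_add_distrib]
  rw [WeightedPDA.isErtBound_iff]
  simp only [key, boundViolations, Finset.sum_eq_zero_iff, Finset.mem_range, ite_eq_left_iff,
    one_ne_zero, imp_false, not_not]
  norm_cast
  exact ⟨fun h p Z => h p p.2 Z Z.2, fun h p hp Z hZ => h ⟨p, hp⟩ ⟨Z, hZ⟩⟩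

theorem deficientRows_ne_zero_iff : deficientRows U c i ≠ 0 ↔
    ∃ p Z, ∑ t, schemeSeq U c i (p, Z, t) < 1 := by
  have key : ∀ (p : Fin c.1) (Z : Fin c.2.1), ∑ t, schemeSeq U c i (p, Z, t) =
      ((∑ t ∈ Finset.range c.1, fracVal (U (c, i, p, Z, t)) : ℚ≥0) : ℝ≥0) := by
    intro p Z
    rw [← Fin.sum_univ_eq_sum_range (fun t => fracVal (U (c, i, p, Z, t)))]
    simp only [schemeSeq]
    push_cast
    rfl
  rw [← not_iff_not]
  push Not
  simp only [key, deficientRows, Finset.sum_eq_zero_iff, Finset.mem_range, ite_eq_left_iff,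
    one_ne_zero, imp_false, not_not]
  norm_cast
  exact ⟨fun h p Z => h p p.2 Z Z.2, fun h p hp Z hZ => h ⟨p, hp⟩ ⟨Z, hZ⟩⟩

/-- One round of the search for a certificate: an index `i` of the scheme and natural numbers that
bound the expected runtimes. -/
def certificate (x : ℕ × List ℕ) : Option Bool :=
  bif decide (boundViolations U c x.1 x.2 = 0) then some true
  else bif decide (deficientRows U c x.1 = 0) then none else some false

variable {U}

section

variable {α : Type*} [Primcodable α] {c : α → PDACode} (hc : Computable c)
include hc

theorem isComputableFrac_natWeight_comp {p Z q : α → ℕ} {w : α → List ℕ} (hp : Computable p)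
    (hZ : Computable Z) (hq : Computable q) (hw : Computable w) :
    IsComputableFrac fun a => (c a).natWeight (p a) (Z a) (q a) (w a) :=
  isComputableFrac_natWeight.comp (hc.pair (hp.pair (hZ.pair (hq.pair hw))))

theorem isComputableFrac_scheme (hU : Computable U) {i p Z q : α → ℕ} (hi : Computable i)
    (hp : Computable p) (hZ : Computable Z) (hq : Computable q) :
    IsComputableFrac fun a => fracVal (U (c a, i a, p a, Z a, q a)) :=
  IsComputableFrac.fracVal (hU.comp (hc.pair (hi.pair (hp.pair (hZ.pair hq)))))

omit hc in
theorem isComputableFrac_entry {l : α → List ℕ} {p Z : α → ℕ} (hl : Computable l)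
    (hp : Computable p) (hZ : Computable Z) :
    IsComputableFrac fun a => (entry (l a) (p a) (Z a) : ℚ≥0) :=
  IsComputableFrac.natCast (Computable.option_getD
    (Computable.list_getElem?.comp hl (Primrec₂.natPair.to_comp.comp hp hZ)) (Computable.const 0))

theorem computable_states : Computable fun a => (c a).1 := Computable.fst.comp hc

theorem computable_symbols : Computable fun a => (c a).2.1 :=
  Computable.fst.comp (Computable.snd.comp hc)

theorem isComputableFrac_boundLhs (hU : Computable U) {i p Z : α → ℕ} {l : α → List ℕ}
    (hi : Computable i) (hl : Computable l) (hp : Computable p) (hZ : Computable Z) :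
    IsComputableFrac fun a => boundLhs U (c a) (i a) (l a) (p a) (Z a) := by
  have f1 : Computable fun x : α × ℕ => x.1 := Computable.fst
  have f2 : Computable fun x : (α × ℕ) × ℕ => x.1.1 := f1.comp Computable.fst
  have f3 : Computable fun x : ((α × ℕ) × ℕ) × ℕ => x.1.1.1 := f2.comp Computable.fst
  have f4 : Computable fun x : (((α × ℕ) × ℕ) × ℕ) × ℕ => x.1.1.1.1 := f3.comp Computable.fst
  have s2 : Computable fun x : (α × ℕ) × ℕ => x.1.2 := Computable.snd.comp Computable.fst
  have s3 : Computable fun x : ((α × ℕ) × ℕ) × ℕ => x.1.1.2 := s2.comp Computable.fst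
  have s4 : Computable fun x : (((α × ℕ) × ℕ) × ℕ) × ℕ => x.1.1.1.2 := s3.comp Computable.fst
  have v2 : Computable fun x : (α × ℕ) × ℕ => x.2 := Computable.snd
  have v3 : Computable fun x : ((α × ℕ) × ℕ) × ℕ => x.1.2 := v2.comp Computable.fst
  have v4 : Computable fun x : (((α × ℕ) × ℕ) × ℕ) × ℕ => x.1.1.2 := v3.comp Computable.fst
  have w3 : Computable fun x : ((α × ℕ) × ℕ) × ℕ => x.2 := Computable.snd
  have w4 : Computable fun x : (((α × ℕ) × ℕ) × ℕ) × ℕ => x.1.2 := w3.comp Computable.fst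
  have t4 : Computable fun x : (((α × ℕ) × ℕ) × ℕ) × ℕ => x.2 := Computable.snd
  have single {β : Type _} [Primcodable β] {g : β → ℕ} (hg : Computable g) :
      Computable fun b => [g b] :=
    Computable.list_cons.comp hg (Computable.const [])
  refine .add (.sum_range (.sum_range (.add (.mul ?_ ?_) (.sum_range (.mul ?_ (.add ?_
    (.sum_range (.mul ?_ ?_) ?_))) ?_)) ?_) (computable_states hc)) .one
  · exact isComputableFrac_natWeight_comp (hc.comp f2) (hp.comp f2) (hZ.comp f2) s2 (single v2)
  · exact isComputableFrac_entry (hl.comp f2) s2 v2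
  · exact isComputableFrac_natWeight_comp (hc.comp f3) (hp.comp f3) (hZ.comp f3) s3
      (Computable.list_cons.comp v3 (single w3))
  · exact isComputableFrac_entry (hl.comp f3) s3 v3
  · exact isComputableFrac_scheme (hc.comp f4) hU (hi.comp f4) s4 v4 t4
  · exact isComputableFrac_entry (hl.comp f4) t4 w4
  · exact computable_states (hc.comp f3)
  · exact computable_symbols (hc.comp f2)
  · exact computable_symbols (hc.comp f1)

theorem isComputableFrac_boundViolations (hU : Computable U) {i : α → ℕ} {l : α → List ℕ}
    (hi : Computable i) (hl : Computable l) :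
    IsComputableFrac fun a => boundViolations U (c a) (i a) (l a) := by
  have f1 : Computable fun x : α × ℕ => x.1 := Computable.fst
  have f2 : Computable fun x : (α × ℕ) × ℕ => x.1.1 := f1.comp Computable.fst
  have p2 : Computable fun x : (α × ℕ) × ℕ => x.1.2 := Computable.snd.comp Computable.fst
  have z2 : Computable fun x : (α × ℕ) × ℕ => x.2 := Computable.snd
  refine .sum_range (.sum_range (.indicator_not_le ?_ ?_) ?_) (computable_states hc)
  · exact isComputableFrac_boundLhs (hc.comp f2) hU (hi.comp f2) (hl.comp f2) p2 z2
  · exact isComputableFrac_entry (hl.comp f2) p2 z2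
  · exact computable_symbols (hc.comp f1)

theorem isComputableFrac_deficientRows (hU : Computable U) {i : α → ℕ} (hi : Computable i) :
    IsComputableFrac fun a => deficientRows U (c a) (i a) := by
  have f1 : Computable fun x : α × ℕ => x.1 := Computable.fst
  have f2 : Computable fun x : (α × ℕ) × ℕ => x.1.1 := f1.comp Computable.fst
  have f3 : Computable fun x : ((α × ℕ) × ℕ) × ℕ => x.1.1.1 := f2.comp Computable.fst
  have p3 : Computable fun x : ((α × ℕ) × ℕ) × ℕ => x.1.1.2 :=
    Computable.snd.comp (Computable.fst.comp Computable.fst)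
  have z3 : Computable fun x : ((α × ℕ) × ℕ) × ℕ => x.1.2 := Computable.snd.comp Computable.fst
  refine .sum_range (.sum_range (.indicator_not_le .one (.sum_range ?_ ?_)) ?_)
    (computable_states hc)
  · exact isComputableFrac_scheme (hc.comp f3) hU (hi.comp f3) p3 z3 Computable.snd
  · exact computable_states (hc.comp f2)
  · exact computable_symbols (hc.comp f1)

end

theorem computable_certificate (hU : Computable U) :
    Computable₂ fun (c : PDACode) (x : ℕ × List ℕ) => certificate U c x := by
  have hc : Computable fun y : PDACode × ℕ × List ℕ => y.1 := Computable.fst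
  have hi : Computable fun y : PDACode × ℕ × List ℕ => y.2.1 := Computable.fst.comp Computable.snd
  have hl : Computable fun y : PDACode × ℕ × List ℕ => y.2.2 := Computable.snd.comp Computable.snd
  exact Computable.cond (isComputableFrac_boundViolations hc hU hi hl).computable_decide_eq_zero
    (Computable.const _) (Computable.cond
      (isComputableFrac_deficientRows hc hU hi).computable_decide_eq_zero
      (Computable.const _) (Computable.const _))

end PDACode

/-- The search dovetails over all pairs of a round and a list of naturals. Restricting to natural
candidates loses nothing by `exists_isErtBound_natCast`. -/
theorem exists_partrec_decidesTermination {U : PDACode × ℕ × ℕ × ℕ × ℕ → ℕ × ℕ}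
    (hU : Computable U) : ∃ A : PDACode →. Bool, Partrec A ∧ ∀ c : PDACode,
      c.toPDA.IsProbabilistic → c.toPDA.IsUpperScheme (schemeSeq U c) →
        DecidesTermination c.toPDA (A c) := by
  have hcomp : Computable₂ fun (c : PDACode) (k : ℕ) =>
      PDACode.certificate U c (Denumerable.ofNat (ℕ × List ℕ) k) :=
    (PDACode.computable_certificate hU).comp₂ Computable.fst
      ((Computable.ofNat (ℕ × List ℕ)).comp Computable.snd)
  refine ⟨_, Partrec.rfindOpt hcomp, fun c hc hu => ?_⟩
  have hV : ∀ x : ℕ × List ℕ, ∃ k, Denumerable.ofNat (ℕ × List ℕ) k = x := fun x =>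
    ⟨Encodable.encode x, Denumerable.ofNat_encode x⟩
  refine WeightedPDA.decidesTermination_rfindOpt hc (fun k hk => ?_) (fun k hk => ?_)
    (fun h => ?_) fun h => ?_
  · set x := Denumerable.ofNat (ℕ × List ℕ) k
    by_cases h1 : PDACode.boundViolations U c x.1 x.2 = 0
    · exact WeightedPDA.past_of_isErtBound hc (hu.2.1 x.1)
        ((PDACode.boundViolations_eq_zero_iff ..).1 h1)
    · by_cases h2 : PDACode.deficientRows U c x.1 = 0 <;>
        simp [PDACode.certificate, h1, h2] at hk
  · set x := Denumerable.ofNat (ℕ × List ℕ) k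
    by_cases h1 : PDACode.boundViolations U c x.1 x.2 = 0
    · simp [PDACode.certificate, h1] at hk
    · by_cases h2 : PDACode.deficientRows U c x.1 = 0
      · simp [PDACode.certificate, h1, h2] at hk
      · obtain ⟨p, Z, h⟩ := (PDACode.deficientRows_ne_zero_iff ..).1 h2
        exact WeightedPDA.not_ast_of_sum_lt_one (hu.2.1 x.1) h
  · obtain ⟨i, ρ, h⟩ := WeightedPDA.exists_isErtBound_natCast h hu
    obtain ⟨l, hl⟩ := PDACode.exists_entry_eq ρ
    obtain ⟨k, hk⟩ := hV (i, l)
    refine ⟨k, ?_⟩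
    simp only [← hl] at h
    rw [hk]
    simp [PDACode.certificate, (PDACode.boundViolations_eq_zero_iff U c i l).2 h]
  · obtain ⟨i, h⟩ := WeightedPDA.exists_sum_lt_one hc h hu
    -- A deficient row does not involve the candidate vector, so any list will do.
    obtain ⟨k, hk⟩ := hV (i, [])
    refine ⟨k, ?_⟩
    have h2 := (PDACode.deficientRows_ne_zero_iff U c i).2 h
    rw [hk]
    by_cases h1 : PDACode.boundViolations U c i [] = 0 <;>
      simp [PDACode.certificate, h1, h2]

end

theorem corollary1 :
    -- an upper bound on `μf` and a solution `r ≥ 1` prove PAST and bound the expected runtimes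
    (∀ (Q Γ : Type*) [Fintype Q] [Fintype Γ] (Δ : WeightedPDA Q Γ),
      Δ.IsProbabilistic →
      ∀ (u : Q × Γ × Q → ℝ≥0∞), Δ.fundamentalPPS.lfp ≤ u →
      ∀ (r : Q × Γ → ℝ≥0), 1 ≤ r → Δ.IsErtBound u r →
        Δ.PAST ∧ ∀ p Z, Δ.ert p Z ≤ r (p, Z)) ∧
    -- the semi-algorithm is correct for every pPDA and all converging upper bounds
    (∀ (Q Γ : Type*) [Fintype Q] [Fintype Γ] (Δ : WeightedPDA Q Γ),
      Δ.IsProbabilistic →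
      ∀ u : ℕ → Q × Γ × Q → ℝ≥0∞, Δ.IsUpperScheme u →
        DecidesTermination Δ (Δ.semiAlgorithm u)) ∧
    -- every computable scheme of rational upper bounds yields a partial recursive decision
    (∀ U : PDACode × ℕ × ℕ × ℕ × ℕ → ℕ × ℕ, Computable U →
      ∃ A : PDACode →. Bool, Partrec A ∧
        ∀ c : PDACode, c.toPDA.IsProbabilistic → c.toPDA.IsUpperScheme (schemeSeq U c) →
          DecidesTermination c.toPDA (A c)) := by
  refine ⟨fun Q Γ _ _ Δ hΔ u hu r _ hr => ⟨WeightedPDA.past_of_isErtBound hΔ hu hr, fun p Z => ?_⟩,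
    fun Q Γ _ _ Δ hΔ u hu => WeightedPDA.decidesTermination_semiAlgorithm hΔ hu,
    fun U hU => exists_partrec_decidesTermination hU⟩
  rw [WeightedPDA.ert_eq]
  exact Δ.expTime_le_of_isErtBound hu hr p Z
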